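/- Let $(\mathcal X,\mathcal B)$ be a measurable space and let $\mathcal C\subseteq\{0,1\}^{\mathcal X}$ be a class of measurable functions. For $S\in\mathcal X^m$ put $\widehat L_S(h,c)=\frac1m\sum_{i=1}^m\mathbf 1[h(S_i)\ne c(S_i)]$ (and $0$ if $m=0$), for a probability measure $\mu$ on $\mathcal X$ put $L_\mu(h,c)=\mu\{x:h(x)\neq c(x)\}$, and let $\mu^{2m}=\mu^m\otimes\mu^m$. For $p=(S,T)\in\mathcal X^m\times\mathcal X^m$ let $\Gamma^c_h(p)=\widehat L_T(h,c)-\widehat L_S(h,c)$, let $$E_{\mathcal C,c,m,\varepsilon}=\{p:\exists h\in\mathcal C,\ \Gamma^c_h(p)\ge\varepsilon/2\},\qquad G_{\mathcal C,c,m}(p)=\sup_{h\in\mathcal C}\Gamma^c_h(p).$$ Say that $\mathrm{WB}_{\mathrm{meas}}(\mathcal C)$ holds if for every probability measure $\mu$, every measurable $c:\mathcal X\to\{0,1\}$, every $m\in\mathbb N$ and every $\varepsilon>0$ the set $E_{\mathcal C,c,m,\varepsilon}$ is measurable in the completion of $\mu^{2m}$. Let $\Pi_{\mathcal C}(n)$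 be the maximal number of labelings of $n$ points induced by $\mathcal C$. Below, the measure of a possibly non-measurable set is its outer measure. Then the following hold. 1. (Realizable interface.) If $\mathrm{WB}_{\mathrm{meas}}(\mathcal C)$ holds, then for every probability measure $\mu$, every target $c\in\mathcal C$, every $m\in\mathbb N$ and every $\varepsilon>0$, the event $E=E_{\mathcal C,c,m,\varepsilon}$ is measurable in the completion of $\mu^{2m}$, its indicator is $\mu^{2m}$-a.e. measurable, and $\int\mathbf 1_E\,d\mu^{2m}=\mu^{2m}(E)$ (lower Lebesgue integral). 2. (Only this event-level measurability is needed in one-sided symmetrization.) For every probability measure $\mu$, $c\in\mathcal C$, $m\in\mathbb N$ and $\varepsilon>0$, the event $E=E_{\mathcal C,c,m,\varepsilon}$ is measurable in the completion of $\mu^{2m}$ if and only if $\mathbf 1_E$ is $\mu^{2m}$-a.e. measurable; and if $E$ is measurable in the completion of $\mu^{2m}$, then: (a) if $m\varepsilon^2\ge2$, then $\mu^m\{S:\exists h\in\mathcal C,\ L_\mu(h,c)-\widehat L_S(h,c)\ge\varepsilon\}\le 2\,\mu^{2m}(E)$; (b) $\mu^{2m}(E)=\int 2^{-m}\sum_{\sigma\in\{0,1\}^m}\mathbf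 1_E(\sigma p)\,d\mu^{2m}(p)$ (lower Lebesgue integral), where $\sigma p$ is obtained from $p=(S,T)$ by exchanging $S_i$ and $T_i$ for every $i$ with $\sigma_i=1$; (c) $\mu^{2m}(E)\le \Pi_{\mathcal C}(2m)\,e^{-m\varepsilon^2/8}$. 3. (Realizable PAC conclusion.) If $\mathrm{WB}_{\mathrm{meas}}(\mathcal C)$ holds and $\mathcal C$ has finite VC dimension, then every learner that, on each sample labeled by a target in $\mathcal C$, returns a concept in $\mathcal C$ with no error on that sample is a proper PAC learner for $\mathcal C$ in the realizable setting: for all $\varepsilon,\delta\in(0,1)$ there is $m_0$ such that for all $m\ge m_0$, all probability measures $\mu$ and all $c\in\mathcal C$, the set of $S\in\mathcal X^m$ for which the returned concept $h$ has $L_\mu(h,c)>\varepsilon$ has $\mu^m$-measure at most $\delta$. Moreover, a proper PAC learner for $\mathcal C$ exists. 4. (Measurability of the ghost-gap supremum is not assumed and does not follow.) In 1--3 the map $G_{\mathcal C,c,m}$ is not assumed to be measurable. Nor is its measurability implied: there are a measurable space $\mathcal Y$ and a class $\mathcal D$ of measurable functions $\mathcal Y\to\{0,1\}$ with finite VC dimension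 such that $\mathrm{WB}_{\mathrm{meas}}(\mathcal D)$ holds, while for some $c\in\mathcal D$ and $m\in\mathbb N$ the map $G_{\mathcal D,c,m}$ is not measurable for the product $\sigma$-algebra. -/

import Mathlib

open MeasureTheory
open scoped ENNReal

namespace GhostGap

noncomputable section

/-- Empirical zero-one error of `h` against the target `c` on the sample `S`; it is `0` on the
empty sample. -/
def empError {X : Type*} {m : ℕ} (S : Fin m → X) (h c : X → Bool) : ℝ :=
  (1 / (m : ℝ)) * ∑ i : Fin m, if h (S i) ≠ c (S i) then (1 : ℝ) else 0

/-- True zero-one error of `h` against the target `c` under `μ`. -/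
def trueError {X : Type*} [MeasurableSpace X] (μ : Measure X) (h c : X → Bool) : ℝ :=
  μ.real {x | h x ≠ c x}

/-- One-sided ghost gap at a pair `p = (S, T)` of a training sample `S` and a ghost sample `T`. -/
def ghostGap {X : Type*} {m : ℕ} (c h : X → Bool) (p : (Fin m → X) × (Fin m → X)) : ℝ :=
  empError p.2 h c - empError p.1 h c

/-- The one-sided bad event: some concept in the class has ghost gap at least `ε / 2`. -/
def badEvent {X : Type*} (C : Set (X → Bool)) (c : X → Bool) (m : ℕ) (ε : ℝ) :
    Set ((Fin m → X) × (Fin m → X)) :=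
  {p | ∃ h ∈ C, ε / 2 ≤ ghostGap c h p}

/-- The ghost-gap supremum map. For a nonempty class the supremum is over a nonempty finite set of
values. -/
def ghostSup {X : Type*} (C : Set (X → Bool)) (c : X → Bool) (m : ℕ)
    (p : (Fin m → X) × (Fin m → X)) : ℝ :=
  ⨆ h : C, ghostGap c h.1 p

/-- The law of an i.i.d. sample of size `m`. -/
def sampleMeasure {X : Type*} [MeasurableSpace X] (μ : Measure X) (m : ℕ) :
    Measure (Fin m → X) :=
  Measure.pi fun _ : Fin m => μ

/-- The law of an independent pair of i.i.d. samples of size `m`. -/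
def doubleMeasure {X : Type*} [MeasurableSpace X] (μ : Measure X) (m : ℕ) :
    Measure ((Fin m → X) × (Fin m → X)) :=
  (sampleMeasure μ m).prod (sampleMeasure μ m)

/-- Event-level null-measurability for measurable targets: every one-sided bad event is measurable
in the completion of every double-sample product measure. -/
def WBMeas {X : Type*} [MeasurableSpace X] (C : Set (X → Bool)) : Prop :=
  ∀ μ : Measure X, IsProbabilityMeasure μ → ∀ c : X → Bool, Measurable c →
    ∀ (m : ℕ) (ε : ℝ), 0 < ε → NullMeasurableSet (badEvent C c m ε) (doubleMeasure μ m)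

/-- The deviation event on training samples: some concept in the class has true error exceeding
its empirical error by at least `ε`. -/
def deviationEvent {X : Type*} [MeasurableSpace X] (C : Set (X → Bool)) (μ : Measure X)
    (c : X → Bool) (m : ℕ) (ε : ℝ) : Set (Fin m → X) :=
  {S | ∃ h ∈ C, ε ≤ trueError μ h c - empError S h c}

/-- Exchange the `i`-th training point and the `i`-th ghost point whenever `σ i` is true. -/
def swapPair {X : Type*} {m : ℕ} (σ : Fin m → Bool) (p : (Fin m → X) × (Fin m → X)) :
    (Fin m → X) × (Fin m → X) :=
  (fun i => if σ i then p.2 i else p.1 i, fun i => if σ i then p.1 i else p.2 i)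

/-- The growth function: the maximal number of labelings of `n` points induced by the class. -/
def growth {X : Type*} (C : Set (X → Bool)) (n : ℕ) : ℕ :=
  ⨆ x : Fin n → X, ((fun h : X → Bool => h ∘ x) '' C).ncard

/-- The class realizes every labeling of the finite set `A`. -/
def Shatters {X : Type*} (C : Set (X → Bool)) (A : Finset X) : Prop :=
  ∀ f : X → Bool, ∃ h ∈ C, ∀ x ∈ A, h x = f x

/-- The Vapnik-Chervonenkis dimension (`0` for the empty class, by convention). -/
def vcDim {X : Type*} (C : Set (X → Bool)) : ℕ∞ :=
  ⨆ (A : Finset X) (_ : Shatters C A), (A.card : ℕ∞)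

/-- A learner turns a labeled sample of any size into a hypothesis. -/
abbrev Learner (X : Type*) := (m : ℕ) → (Fin m → X × Bool) → X → Bool

/-- The hypothesis that the learner returns on the sample `S` labeled by the target `c`. -/
def Learner.output {X : Type*} (A : Learner X) (c : X → Bool) {m : ℕ} (S : Fin m → X) : X → Bool :=
  A m fun i => (S i, c (S i))

/-- On samples labeled by a target in the class, the learner returns a concept in the class that
makes no error on the sample. -/
def IsConsistentLearner {X : Type*} (C : Set (X → Bool)) (A : Learner X) : Prop :=
  ∀ c ∈ C, ∀ (m : ℕ) (S : Fin m → X), A.output c S ∈ C ∧ ∀ i, A.output c S (S i) = c (S i)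

/-- `A` is a proper PAC learner for `C` in the realizable setting. The sample size depends only on
`C`, `A`, `ε` and `δ`. The measure of a set which need not be measurable is its outer measure. -/
def IsPACLearner {X : Type*} [MeasurableSpace X] (C : Set (X → Bool)) (A : Learner X) : Prop :=
  (∀ c ∈ C, ∀ (m : ℕ) (S : Fin m → X), A.output c S ∈ C) ∧
  ∀ ε δ : ℝ, 0 < ε → ε < 1 → 0 < δ → δ < 1 → ∃ m₀ : ℕ, ∀ m : ℕ, m₀ ≤ m →
    ∀ μ : Measure X, IsProbabilityMeasure μ → ∀ c ∈ C,
      sampleMeasure μ m {S | ε < trueError μ (A.output c S) c} ≤ ENNReal.ofReal δ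

end

end GhostGap

/-!
The one-sided symmetrization argument never integrates the ghost-gap supremum; the only set whose
measurability enters is the bad event `E`.

*Symmetrization* (`sampleMeasure_deviationEvent_le`). If the training sample `S` deviates, with
witness `h`, then by Chebyshev's inequality a ghost sample `T` has `empError T h c` within `ε / 2`
of the true error with probability at least `1 / 2`, so that `(S, T) ∈ E`. Hence the sections of `E`
over deviating samples have measure at least `1 / 2`. Markov's inequality for the sections of a
measurable hull of `E` gives the factor `2`.

*Random swaps* (`doubleMeasure_eq_lintegral_swapPair`, `doubleMeasure_badEvent_le`). Exchanging the
`i`-th coordinates of `S` and `T` preserves the double-sample law, so for null-measurable `E` its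
measure is the integral of the proportion of swaps that lead into `E`. For a fixed double sample
only the labelings of its `2 * m` points matter; each labeling is treated by Hoeffding's inequality
for random signs (`card_filter_le_sum_swapSign_mul`), and there are at most `growth C (2 * m)` of
them.

*Learning* (`isPACLearner_of_isConsistentLearner`). By the Sauer-Shelah lemma the growth function of
a class of finite VC dimension is polynomial (`growth_le_of_shatters_card_le`), so the bound tends
to `0` uniformly in the law and the target. A consistent output that errs by more than `ε` puts the
sample into the deviation event, and outer measure is monotone.

*Separation* (`exists_wbMeas_not_measurable_ghostSup`). Let `A` be an analytic subset of `ℕ → ℕ`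
that is not Borel, and consider the indicators of the points of `A` together with the zero concept.
Each bad event is the union of a Borel set and a projection along `A` of a Borel set, hence it is
analytic, hence universally measurable (`nullMeasurableSet_of_analyticSet`). At sample size one and
target zero, however, a section of the ghost-gap supremum is, up to one point, the indicator of `A`.
-/

namespace GhostGap

open Set Filter Topology

/-! ### Analytic sets: universal measurability and a non-Borel example -/

/-- The bounded boxes `{x | ∀ i < n, x i ≤ k i}` in Baire space decrease to a compact box `K`, and
their images under a continuous map decrease to the image of `K`, even after taking closures. -/
theorem iInter_closure_image_subset_image_Iic {α : Type*} [TopologicalSpace α]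
    [TopologicalSpace.MetrizableSpace α] {f : (ℕ → ℕ) → α} (hf : Continuous f) (k : ℕ → ℕ) :
    ⋂ n, closure (f '' {x | ∀ i < n, x i ≤ k i}) ⊆ f '' Iic k := by
  let := TopologicalSpace.metrizableSpaceMetric α
  intro y hy
  have hpick : ∀ n : ℕ, ∃ x : ℕ → ℕ, (∀ i < n, x i ≤ k i) ∧ dist y (f x) < 1 / ((n : ℝ) + 1) := by
    intro n
    obtain ⟨_, ⟨x, hx, rfl⟩, hd⟩ := Metric.mem_closure_iff.1 (mem_iInter.1 hy n) (1 / ((n : ℝ) + 1))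
      (by positivity)
    exact ⟨x, hx, hd⟩
  choose x hx hd using hpick
  -- The truncations `x n ⊓ k` lie in the compact box and agree with `x n` on the first `n` places.
  have hK : IsCompact (Iic k) := by
    have : Iic k = Icc (fun _ => 0) k := by
      ext z; simp [Pi.le_def]
    rw [this, ← pi_univ_Icc]
    exact isCompact_univ_pi fun i => (finite_Icc _ _).isCompact
  obtain ⟨z, hz, φ, hφ, hlim⟩ := hK.tendsto_subseq (x := fun n => x n ⊓ k) fun n =>
    show x n ⊓ k ≤ k from inf_le_right
  have hxz : Tendsto (fun n => x (φ n)) atTop (𝓝 z) := by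
    rw [tendsto_pi_nhds] at hlim ⊢
    intro i
    refine (hlim i).congr' ?_
    filter_upwards [eventually_gt_atTop i] with n hn
    exact inf_eq_left.2 (hx (φ n) i (hn.trans_le (hφ.id_le n)))
  have h1 : Tendsto (fun n => f (x (φ n))) atTop (𝓝 (f z)) := (hf.tendsto z).comp hxz
  have h2 : Tendsto (fun n => f (x n)) atTop (𝓝 y) := by
    rw [tendsto_iff_dist_tendsto_zero]
    refine squeeze_zero (fun _ => dist_nonneg) (fun n => ?_)
      (tendsto_one_div_add_atTop_nhds_zero_nat (𝕜 := ℝ))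
    rw [dist_comm]
    exact (hd n).le
  exact ⟨z, hz, tendsto_nhds_unique h1 (h2.comp hφ.tendsto_atTop)⟩

/-- Capacitability for a finite measure: the range of a continuous map on Baire space contains
measurable sets whose measure is arbitrarily close to its outer measure. -/
theorem exists_measurable_subset_range_lt {α : Type*} [TopologicalSpace α]
    [TopologicalSpace.MetrizableSpace α] [MeasurableSpace α] [OpensMeasurableSpace α]
    (μ : Measure α) [IsFiniteMeasure μ] {f : (ℕ → ℕ) → α} (hf : Continuous f)
    {r : ℝ≥0∞} (hr : r < μ (range f)) :
    ∃ K ⊆ range f, MeasurableSet K ∧ r ≤ μ K := by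
  -- Outer measure is continuous along increasing unions of arbitrary sets, so the coordinates can
  -- be bounded one at a time while the measure of the image stays above `r`.
  have step : ∀ B : Set (ℕ → ℕ), r < μ (f '' B) → ∀ n : ℕ,
      ∃ b : ℕ, r < μ (f '' (B ∩ {x | x n ≤ b})) := by
    intro B hB n
    have hU : f '' B = ⋃ b : ℕ, f '' (B ∩ {x | x n ≤ b}) := by
      rw [← image_iUnion, ← inter_iUnion]
      congr 1
      refine (inter_eq_left.2 fun x _ => ?_).symm
      exact mem_iUnion.2 ⟨x n, le_refl (x n)⟩
    have hmono : Monotone fun b : ℕ => f '' (B ∩ {x | x n ≤ b}) := fun a b hab =>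
      image_mono (inter_subset_inter_right _ fun x (hx : x n ≤ a) => hx.trans hab)
    rw [hU, hmono.measure_iUnion, lt_iSup_iff] at hB
    exact hB
  choose! b hb using step
  let B : ℕ → Set (ℕ → ℕ) := fun n =>
    Nat.rec univ (fun n B => B ∩ {x | x n ≤ b B n}) n
  have hBr : ∀ n, r < μ (f '' B n) := by
    intro n
    induction n with
    | zero => simpa [B] using hr
    | succ n ih => exact hb _ ih n
  have hBk : ∀ n, B n = {x | ∀ i < n, x i ≤ b (B i) i} := by
    intro n
    induction n with
    | zero => simp [B]
    | succ n ih =>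
      have : B (n + 1) = B n ∩ {x | x n ≤ b (B n) n} := rfl
      rw [this]
      ext x
      constructor
      · rintro ⟨h1, h2⟩ i hi
        rw [ih] at h1
        rcases Nat.lt_succ_iff_lt_or_eq.1 hi with h | rfl
        · exact h1 i h
        · exact h2
      · intro h
        refine ⟨?_, h n n.lt_succ_self⟩
        rw [ih]
        exact fun i hi => h i (hi.trans n.lt_succ_self)
  set k : ℕ → ℕ := fun i => b (B i) i
  refine ⟨⋂ n, closure (f '' B n), ?_, ?_, ?_⟩
  · exact (iInter_mono fun n => closure_mono (image_mono (hBk n).subset)).trans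
      ((iInter_closure_image_subset_image_Iic hf k).trans (image_subset_range f (Iic k)))
  · exact MeasurableSet.iInter fun n => isClosed_closure.measurableSet
  · have hanti : Antitone fun n => closure (f '' B n) := by
      refine antitone_nat_of_succ_le fun n => closure_mono (image_mono ?_)
      exact inter_subset_left
    rw [hanti.measure_iInter (fun n => isClosed_closure.measurableSet.nullMeasurableSet)
      ⟨0, measure_ne_top _ _⟩]
    exact le_iInf fun n => (hBr n).le.trans (measure_mono subset_closure)

/-- Analytic sets are universally measurable. -/
theorem nullMeasurableSet_of_analyticSet {α : Type*} [TopologicalSpace α]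
    [TopologicalSpace.MetrizableSpace α] [MeasurableSpace α] [OpensMeasurableSpace α]
    {s : Set α} (hs : AnalyticSet s) (μ : Measure α) [IsFiniteMeasure μ] :
    NullMeasurableSet s μ := by
  rw [AnalyticSet] at hs
  rcases hs with rfl | ⟨f, hf, rfl⟩
  · exact nullMeasurableSet_empty
  rcases eq_or_ne (μ (range f)) 0 with h0 | h0
  · exact NullMeasurableSet.of_null h0
  obtain ⟨u, -, hu, hlim⟩ := exists_seq_strictMono_tendsto' (pos_iff_ne_zero.2 h0)
  choose K hKs hKm hKr using fun n => exists_measurable_subset_range_lt μ hf (hu n).2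
  have hle : μ (range f) ≤ μ (⋃ n, K n) :=
    le_of_tendsto' hlim fun n => (hKr n).trans (measure_mono (subset_iUnion K n))
  have hKM : MeasurableSet (⋃ n, K n) := MeasurableSet.iUnion hKm
  have hsub : ⋃ n, K n ⊆ range f := iUnion_subset hKs
  have hae : (⋃ n, K n) =ᵐ[μ] toMeasurable μ (range f) := by
    refine ae_eq_of_subset_of_measure_ge (hsub.trans (subset_toMeasurable _ _)) ?_
      hKM.nullMeasurableSet (measure_ne_top _ _)
    rwa [measure_toMeasurable]
  refine hKM.nullMeasurableSet.congr (EventuallyLE.antisymm hsub.eventuallyLE ?_)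
  exact (subset_toMeasurable μ (range f)).eventuallyLE.trans hae.symm.le

/-- Diagonalizing a closed set that is universal for closed subsets of `(ℕ → ℕ) × (ℕ → ℕ)` yields
an analytic set whose complement is not analytic. -/
theorem exists_analyticSet_not_measurableSet :
    ∃ A : Set (ℕ → ℕ), AnalyticSet A ∧ ¬ MeasurableSet A := by
  obtain ⟨V, hV⟩ := TopologicalSpace.exists_countable_basis ((ℕ → ℕ) × (ℕ → ℕ))
  obtain ⟨hVc, -, hVb⟩ := hV
  have hVne : V.Nonempty := by
    by_contra h
    rw [not_nonempty_iff_eq_empty] at h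
    have := hVb.sUnion_eq
    rw [h, sUnion_empty] at this
    exact (univ_nonempty (α := (ℕ → ℕ) × (ℕ → ℕ))).ne_empty this.symm
  obtain ⟨v, rfl⟩ := hVc.exists_eq_range hVne
  -- The point `z` codes the open set `⋃ n ∈ {n | z n = 1}, v n`.
  let W : Set ((ℕ → ℕ) × (ℕ → ℕ)) := {q | ∀ n, q.1 n = 1 → q ∉ v n}
  have hW : IsClosed W := by
    have : W = ⋂ n, ({q | q.1 n = 1} ∩ v n)ᶜ := by
      ext q; simp [W]
    rw [this]
    refine isClosed_iInter fun n => IsOpen.isClosed_compl (IsOpen.inter ?_ ?_)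
    · exact (isOpen_discrete ({1} : Set ℕ)).preimage
        (show Continuous fun q : (ℕ → ℕ) × (ℕ → ℕ) => q.1 n by fun_prop)
    · exact hVb.isOpen ⟨n, rfl⟩
  refine ⟨Prod.fst '' W, hW.analyticSet.image_of_continuous continuous_fst, fun hA => ?_⟩
  have hAc : AnalyticSet (Prod.fst '' W)ᶜ := hA.compl.analyticSet
  obtain ⟨F, hF, hFA⟩ : ∃ F : Set ((ℕ → ℕ) × (ℕ → ℕ)), IsClosed F ∧
      Prod.fst '' F = (Prod.fst '' W)ᶜ := by
    rw [AnalyticSet] at hAc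
    rcases hAc with h | ⟨f, hf, h⟩
    · exact ⟨∅, isClosed_empty, by simp [h]⟩
    · refine ⟨{q | q.1 = f q.2}, isClosed_eq continuous_fst (hf.comp continuous_snd), ?_⟩
      rw [← h]
      ext x
      constructor
      · rintro ⟨⟨a, y⟩, hq, rfl⟩
        exact ⟨y, hq.symm⟩
      · rintro ⟨y, rfl⟩
        exact ⟨(f y, y), rfl, rfl⟩
  classical
  -- A code of the open set `Fᶜ`.
  let z : ℕ → ℕ := fun n => if v n ⊆ Fᶜ then 1 else 0
  have hz : ∀ q : (ℕ → ℕ) × (ℕ → ℕ), q ∈ F ↔ ∀ n, z n = 1 → q ∉ v n := by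
    intro q
    constructor
    · intro hq n hn hqn
      have : v n ⊆ Fᶜ := by
        by_contra h
        simp [z, h] at hn
      exact this hqn hq
    · intro h
      by_contra hq
      obtain ⟨_, ⟨n, rfl⟩, hqn, hsub⟩ :=
        hVb.exists_subset_of_mem_open (show q ∈ Fᶜ from hq) hF.isOpen_compl
      exact h n (by simp [z, hsub]) hqn
  have key : z ∈ Prod.fst '' W ↔ z ∈ Prod.fst '' F := by
    constructor
    · rintro ⟨⟨a, y⟩, hq, rfl⟩
      exact ⟨(z, y), (hz _).2 hq, rfl⟩
    · rintro ⟨⟨a, y⟩, hq, h⟩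
      obtain rfl : a = z := h
      exact ⟨(z, y), (hz _).1 hq, rfl⟩
  rw [hFA] at key
  exact iff_not_self key

/-! ### A class of finite VC dimension with a non-measurable ghost-gap supremum -/

open Classical in
/-- The indicators of the points of `A`, together with the zero concept. -/
def pointClass {Y : Type*} (A : Set Y) : Set (Y → Bool) :=
  insert (fun _ => false) ((fun a y => decide (y = a)) '' A)

theorem measurable_of_mem_pointClass {Y : Type*} [MeasurableSpace Y] [MeasurableSingletonClass Y]
    {A : Set Y} {h : Y → Bool} (hh : h ∈ pointClass A) : Measurable h := by
  classical
  rcases hh with rfl | ⟨a, -, rfl⟩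
  · exact measurable_const
  · refine measurable_to_bool ?_
    have : (fun y => decide (y = a)) ⁻¹' {true} = {a} := by ext; simp
    rw [this]
    exact measurableSet_singleton a

theorem vcDim_pointClass_le_one {Y : Type*} (A : Set Y) : vcDim (pointClass A) ≤ 1 := by
  refine iSup₂_le fun s hs => ?_
  have : s.card ≤ 1 := by
    obtain ⟨h, hh, hs⟩ := hs fun _ => true
    refine Finset.card_le_one.2 fun x hx y hy => ?_
    have h1 := hs x hx
    have h2 := hs y hy
    rcases hh with rfl | ⟨a, -, rfl⟩
    · simp at h1
    · simp only [decide_eq_true_eq] at h1 h2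
      rw [h1, h2]
  exact_mod_cast this

theorem measurable_empError {X Z : Type*} [MeasurableSpace X] [MeasurableSpace Z] {m : ℕ}
    {S : Z → Fin m → X} {h : Z → X → Bool} {c : X → Bool}
    (hS : Measurable S) (hh : Measurable fun q : Z × X => h q.1 q.2) (hc : Measurable c) :
    Measurable fun z => empError (S z) (h z) c := by
  unfold empError
  refine measurable_const.mul (Finset.measurable_sum _ fun i _ => ?_)
  have hSi : Measurable fun z => S z i := (measurable_pi_apply i).comp hS
  refine Measurable.ite ?_ measurable_const measurable_const
  exact (measurableSet_eq_fun (hh.comp (measurable_id.prodMk hSi)) (hc.comp hSi)).compl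

theorem measurable_ghostGap {X Z : Type*} [MeasurableSpace X] [MeasurableSpace Z] {m : ℕ}
    {h : Z → X → Bool} {c : X → Bool} {p : Z → (Fin m → X) × (Fin m → X)}
    (hc : Measurable c) (hh : Measurable fun q : Z × X => h q.1 q.2) (hp : Measurable p) :
    Measurable fun z => ghostGap c (h z) (p z) :=
  (measurable_empError (measurable_snd.comp hp) hh hc).sub
    (measurable_empError (measurable_fst.comp hp) hh hc)

/-- The bad events of the point class of an analytic set are projections along that set of Borel
sets, hence analytic. -/
theorem wbMeas_pointClass {Y : Type*} [TopologicalSpace Y] [PolishSpace Y] [MeasurableSpace Y]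
    [BorelSpace Y] {A : Set Y} (hA : AnalyticSet A) : WBMeas (pointClass A) := by
  classical
  intro μ hμ c hc m ε _
  have : IsFiniteMeasure (doubleMeasure μ m) := by
    unfold doubleMeasure sampleMeasure; infer_instance
  have hsplit : badEvent (pointClass A) c m ε =
      {p | ε / 2 ≤ ghostGap c (fun _ => false) p} ∪
        Prod.snd '' ((Prod.fst ⁻¹' A) ∩
          {q : Y × ((Fin m → Y) × (Fin m → Y)) |
            ε / 2 ≤ ghostGap c (fun y => decide (y = q.1)) q.2}) := by
    ext p
    constructor
    · rintro ⟨h, rfl | ⟨a, ha, rfl⟩, hp⟩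
      · exact Or.inl hp
      · exact Or.inr ⟨(a, p), ⟨ha, hp⟩, rfl⟩
    · rintro (hp | ⟨⟨a, p'⟩, ⟨ha, hp⟩, rfl⟩)
      · exact ⟨_, Or.inl rfl, hp⟩
      · exact ⟨_, Or.inr ⟨a, ha, rfl⟩, hp⟩
  rw [hsplit]
  refine NullMeasurableSet.union (MeasurableSet.nullMeasurableSet ?_)
    (nullMeasurableSet_of_analyticSet ?_ _)
  · exact measurableSet_le measurable_const
      (measurable_ghostGap (h := fun _ _ => false) hc measurable_const measurable_id)
  · refine AnalyticSet.image_of_continuous ?_ continuous_snd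
    have hB : MeasurableSet {q : Y × ((Fin m → Y) × (Fin m → Y)) |
        ε / 2 ≤ ghostGap c (fun y => decide (y = q.1)) q.2} := by
      have hdiag : Measurable fun r : Y × Y => decide (r.1 = r.2) := by
        refine measurable_to_bool ?_
        have : (fun r : Y × Y => decide (r.1 = r.2)) ⁻¹' {true} = diagonal Y := by ext; simp
        rw [this]
        exact measurableSet_diagonal
      have hh : Measurable fun r : (Y × ((Fin m → Y) × (Fin m → Y))) × Y =>
          decide (r.2 = r.1.1) :=
        hdiag.comp (measurable_snd.prodMk measurable_fst.fst)
      have hgap := measurable_ghostGap (Z := Y × ((Fin m → Y) × (Fin m → Y)))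
        (h := fun q y => decide (y = q.1)) (p := Prod.snd) hc hh measurable_snd
      exact measurableSet_le measurable_const hgap
    rw [inter_eq_iInter]
    refine AnalyticSet.iInter fun b => ?_
    cases b
    · exact hB.analyticSet
    · exact hA.preimage continuous_fst

/-- At sample size one and target `0`, fixing the training point `s` recovers `A` up to `s` from
the supremum map. -/
theorem not_measurable_ghostSup_pointClass {Y : Type*} [MeasurableSpace Y]
    [MeasurableSingletonClass Y] [Nonempty Y] {A : Set Y} (hA : ¬ MeasurableSet A) :
    ¬ Measurable (ghostSup (pointClass A) (fun _ => false) 1) := by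
  classical
  intro hG
  obtain ⟨s⟩ := ‹Nonempty Y›
  have hmeas : Measurable fun t : Y =>
      ghostSup (pointClass A) (fun _ => false) 1 (fun _ => s, fun _ => t) :=
    hG.comp (measurable_const.prodMk (measurable_pi_lambda _ fun _ => measurable_id))
  have hgap : ∀ (h : Y → Bool) (t : Y), ghostGap (fun _ => false) h
      ((fun _ => s, fun _ => t) : (Fin 1 → Y) × (Fin 1 → Y)) =
      (if h t = true then (1 : ℝ) else 0) - if h s = true then (1 : ℝ) else 0 := by
    intro h t
    simp [ghostGap, empError]
  have hset : {t | 1 ≤ ghostSup (pointClass A) (fun _ => false) 1 (fun _ => s, fun _ => t)} =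
      A \ {s} := by
    ext t
    have hbdd : BddAbove (range fun h : pointClass A => ghostGap (fun _ => false) h.1
        ((fun _ => s, fun _ => t) : (Fin 1 → Y) × (Fin 1 → Y))) := by
      refine ⟨1, ?_⟩
      rintro _ ⟨h, rfl⟩
      simp only [hgap]
      split_ifs <;> norm_num
    constructor
    · intro ht
      by_contra hts
      have hle : ghostSup (pointClass A) (fun _ => false) 1 (fun _ => s, fun _ => t) ≤ 0 := by
        have : Nonempty (pointClass A) := ⟨⟨_, Or.inl rfl⟩⟩
        refine ciSup_le ?_
        rintro ⟨h, rfl | ⟨a, ha, rfl⟩⟩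
        · simp [hgap]
        · rw [hgap]
          by_cases hta : t = a
          · subst hta
            have : s = t := by
              by_contra h
              exact hts ⟨ha, fun h' => h h'.symm⟩
            simp [this]
          · simp only [hta, decide_false, Bool.false_eq_true, if_false]
            split_ifs <;> norm_num
      have ht' : (1 : ℝ) ≤ _ := ht
      linarith
    · rintro ⟨htA, hts⟩
      have hst : ¬ s = t := fun h => hts h.symm
      refine le_ciSup_of_le hbdd ⟨fun y => decide (y = t), Or.inr ⟨t, htA, ?_⟩⟩ ?_
      · funext y; congr
      · rw [hgap]
        simp [hst]
  have hAs : MeasurableSet (A \ {s}) := hset ▸ measurableSet_le measurable_const hmeas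
  refine hA ?_
  by_cases hs : s ∈ A
  · rw [← sdiff_union_of_subset (singleton_subset_iff.2 hs)]
    exact hAs.union (measurableSet_singleton s)
  · rwa [sdiff_singleton_eq_self hs] at hAs

theorem exists_wbMeas_not_measurable_ghostSup :
    ∃ (Y : Type) (_ : MeasurableSpace Y) (D : Set (Y → Bool)),
      (∀ h ∈ D, Measurable h) ∧ WBMeas D ∧ vcDim D < ⊤ ∧
      ∃ c ∈ D, ∃ m : ℕ, ¬ Measurable (ghostSup D c m) := by
  obtain ⟨A, hA, hAm⟩ := exists_analyticSet_not_measurableSet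
  refine ⟨ℕ → ℕ, inferInstance, pointClass A, fun h hh => measurable_of_mem_pointClass hh,
    wbMeas_pointClass hA, (vcDim_pointClass_le_one A).trans_lt (by decide), fun _ => false,
    Or.inl rfl, 1, not_measurable_ghostSup_pointClass hAm⟩

/-! ### The growth function and the Sauer-Shelah bound -/

theorem ncard_image_comp_le_growth {X : Type*} (C : Set (X → Bool)) {n : ℕ} (x : Fin n → X) :
    ((fun h : X → Bool => h ∘ x) '' C).ncard ≤ growth C n := by
  refine le_ciSup (f := fun x : Fin n → X => ((fun h : X → Bool => h ∘ x) '' C).ncard) ?_ x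
  refine ⟨Nat.card (Fin n → Bool), ?_⟩
  rintro _ ⟨y, rfl⟩
  exact ncard_le_card _

theorem exists_card_le_of_vcDim_lt_top {X : Type*} {C : Set (X → Bool)} (hC : vcDim C < ⊤) :
    ∃ d : ℕ, ∀ s : Finset X, Shatters C s → s.card ≤ d := by
  obtain ⟨d, hd⟩ := ENat.ne_top_iff_exists.1 hC.ne
  refine ⟨d, fun s hs => ?_⟩
  have : (s.card : ℕ∞) ≤ vcDim C := le_iSup₂ (f := fun (A : Finset X) (_ : Shatters C A) =>
    (A.card : ℕ∞)) s hs
  rw [← hd] at this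
  exact_mod_cast this

/-- Polynomial growth of a class of finite VC dimension: the labelings of `n` points, read as
subsets of `Fin n`, form a family to which the Sauer-Shelah lemma applies. Points shattered by the
family are distinct, since a repeated point always receives equal labels. -/
theorem growth_le_of_shatters_card_le {X : Type*} {C : Set (X → Bool)} {d : ℕ}
    (hd : ∀ s : Finset X, Shatters C s → s.card ≤ d) (n : ℕ) :
    growth C n ≤ (d + 1) * (n + 1) ^ d := by
  classical
  refine ciSup_le' fun x => ?_
  set V : Set (Fin n → Bool) := (fun h : X → Bool => h ∘ x) '' C with hV
  let g : (Fin n → Bool) → Finset (Fin n) := fun v => Finset.univ.filter fun i => v i = true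
  have hg : Function.Injective g := by
    intro v w hvw
    funext i
    have : i ∈ g v ↔ i ∈ g w := by rw [hvw]
    simp only [g, Finset.mem_filter, Finset.mem_univ, true_and] at this
    exact Bool.eq_iff_iff.2 this
  let F : Finset (Finset (Fin n)) := V.toFinset.image g
  have hVF : V.ncard = F.card := by
    rw [Finset.card_image_of_injective _ hg, ncard_eq_toFinset_card']
  have hvc : F.vcDim ≤ d := by
    refine Finset.sup_le fun s hs => ?_
    rw [Finset.mem_shatterer] at hs
    have hinj : InjOn x s := by
      intro i hi j hj hij
      by_contra hne
      obtain ⟨u, hu, hui⟩ := hs.exists_inter_eq_singleton hi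
      obtain ⟨v, hv, rfl⟩ := Finset.mem_image.1 hu
      obtain ⟨h, -, rfl⟩ := (mem_toFinset.1 hv : v ∈ V)
      have h1 : i ∈ s ∩ g (h ∘ x) := by rw [hui]; exact Finset.mem_singleton_self i
      have h2 : j ∈ s ∩ g (h ∘ x) := by
        simp only [g, Finset.mem_inter, Finset.mem_filter, Finset.mem_univ, true_and,
          Function.comp] at h1 ⊢
        exact ⟨hj, hij ▸ h1.2⟩
      rw [hui, Finset.mem_singleton] at h2
      exact hne h2.symm
    rw [← Finset.card_image_of_injOn hinj]
    refine hd _ fun f => ?_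
    obtain ⟨u, hu, hut⟩ := hs (Finset.filter_subset (fun i => f (x i) = true) s)
    obtain ⟨v, hv, rfl⟩ := Finset.mem_image.1 hu
    obtain ⟨h, hh, rfl⟩ := (mem_toFinset.1 hv : v ∈ V)
    refine ⟨h, hh, fun y hy => ?_⟩
    obtain ⟨i, hi, rfl⟩ := Finset.mem_image.1 hy
    have := Finset.ext_iff.1 hut i
    simp only [g, Finset.mem_inter, Finset.mem_filter, Finset.mem_univ, true_and, hi,
      Function.comp] at this
    exact Bool.eq_iff_iff.2 this
  calc V.ncard = F.card := hVF
    _ ≤ F.shatterer.card := F.card_le_card_shatterer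
    _ ≤ ∑ k ∈ Finset.Iic F.vcDim, (Fintype.card (Fin n)).choose k :=
      Finset.card_shatterer_le_sum_vcDim
    _ ≤ ∑ k ∈ Finset.Iic d, (n + 1) ^ d := by
      rw [Fintype.card_fin]
      refine (Finset.sum_le_sum_of_subset (Finset.Iic_subset_Iic.2 hvc)).trans
        (Finset.sum_le_sum fun k hk => ?_)
      calc n.choose k ≤ n ^ k := Nat.choose_le_pow n k
        _ ≤ (n + 1) ^ k := Nat.pow_le_pow_left n.le_succ k
        _ ≤ (n + 1) ^ d := Nat.pow_le_pow_right n.succ_pos (Finset.mem_Iic.1 hk)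
    _ = (d + 1) * (n + 1) ^ d := by simp

theorem tendsto_pow_mul_exp_neg_atTop (d : ℕ) {a : ℝ} (ha : 0 < a) :
    Tendsto (fun m : ℕ => (2 * (m : ℝ) + 1) ^ d * Real.exp (-(m * a))) atTop (𝓝 0) := by
  have h1 := tendsto_pow_const_mul_const_pow_of_abs_lt_one d (r := Real.exp (-a))
    (by rw [abs_of_pos (Real.exp_pos _), Real.exp_lt_one_iff]; linarith)
  have h2 := h1.const_mul ((3 : ℝ) ^ d)
  rw [mul_zero] at h2
  refine tendsto_of_tendsto_of_tendsto_of_le_of_le' tendsto_const_nhds h2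
    (Eventually.of_forall fun m => by positivity) ?_
  filter_upwards [eventually_ge_atTop 1] with m hm
  have hm' : (1 : ℝ) ≤ m := by exact_mod_cast hm
  rw [← Real.exp_nat_mul, ← mul_assoc, ← mul_pow, mul_neg]
  gcongr
  linarith

/-! ### Ghost samples and random swaps -/

theorem measurePreserving_swapPair {X : Type*} [MeasurableSpace X] (μ : Measure X)
    [IsProbabilityMeasure μ] {m : ℕ} (σ : Fin m → Bool) :
    MeasurePreserving (swapPair σ) (doubleMeasure μ m) (doubleMeasure μ m) := by
  have he := measurePreserving_arrowProdEquivProdArrow X X (Fin m) (fun _ => μ) (fun _ => μ)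
  have hs : MeasurePreserving (fun (q : Fin m → X × X) i => (if σ i then Prod.swap else id) (q i))
      (Measure.pi fun _ => μ.prod μ) (Measure.pi fun _ => μ.prod μ) := by
    refine measurePreserving_pi _ _ fun i => ?_
    cases σ i
    · exact MeasurePreserving.id _
    · exact Measure.measurePreserving_swap
  have := (he.comp hs).comp (he.symm (MeasurableEquiv.arrowProdEquivProdArrow X X (Fin m)))
  refine (?_ : _ = swapPair σ) ▸ this
  funext p
  refine Prod.ext (funext fun i => ?_) (funext fun i => ?_) <;>
  · cases h : σ i <;>
      simp [swapPair, h, MeasurableEquiv.arrowProdEquivProdArrow, Equiv.arrowProdEquivProdArrow]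

instance isProbabilityMeasure_sampleMeasure {X : Type*} [MeasurableSpace X] (μ : Measure X)
    [IsProbabilityMeasure μ] (m : ℕ) : IsProbabilityMeasure (sampleMeasure μ m) := by
  unfold sampleMeasure; infer_instance

instance isProbabilityMeasure_doubleMeasure {X : Type*} [MeasurableSpace X] (μ : Measure X)
    [IsProbabilityMeasure μ] (m : ℕ) : IsProbabilityMeasure (doubleMeasure μ m) := by
  unfold doubleMeasure; infer_instance

theorem doubleMeasure_eq_lintegral_swapPair {X : Type*} [MeasurableSpace X] (μ : Measure X)
    [IsProbabilityMeasure μ] {m : ℕ} {E : Set ((Fin m → X) × (Fin m → X))}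
    (hE : NullMeasurableSet E (doubleMeasure μ m)) :
    doubleMeasure μ m E =
      ∫⁻ p, (∑ σ : Fin m → Bool, E.indicator (fun _ => (1 : ℝ≥0∞)) (swapPair σ p)) / 2 ^ m
        ∂(doubleMeasure μ m) := by
  have hind := (aemeasurable_indicator_const_iff (1 : ℝ≥0∞)).2 hE
  have hσ : ∀ σ : Fin m → Bool,
      ∫⁻ p, E.indicator (fun _ => (1 : ℝ≥0∞)) (swapPair σ p) ∂(doubleMeasure μ m) =
        doubleMeasure μ m E := by
    intro σ
    have hp := measurePreserving_swapPair μ σ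
    rw [← lintegral_map' (by rwa [hp.map_eq]) hp.aemeasurable, hp.map_eq,
      lintegral_indicator_const₀ hE, one_mul]
  have hmeas : ∀ σ ∈ (Finset.univ : Finset (Fin m → Bool)),
      AEMeasurable (fun p => E.indicator (fun _ => (1 : ℝ≥0∞)) (swapPair σ p))
        (doubleMeasure μ m) := fun σ _ =>
    hind.comp_quasiMeasurePreserving (measurePreserving_swapPair μ σ).quasiMeasurePreserving
  simp_rw [div_eq_mul_inv]
  rw [lintegral_mul_const' _ _ (by simp), lintegral_finsetSum' _ hmeas]
  simp_rw [hσ]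
  rw [Finset.sum_const, Finset.card_univ, Fintype.card_fun, Fintype.card_bool, Fintype.card_fin,
    nsmul_eq_mul, mul_right_comm, Nat.cast_pow, Nat.cast_ofNat,
    ENNReal.mul_inv_cancel (by simp) (by simp), one_mul]

/-- The sign attached to a swap: swapping a pair of points negates its contribution to the ghost
gap. -/
def swapSign (b : Bool) : ℝ := if b then -1 else 1

/-- Hoeffding's inequality for uniform random signs, in counting form. -/
theorem card_filter_le_sum_swapSign_mul {m : ℕ} {d : Fin m → ℝ} (hd : ∀ i, |d i| ≤ 1) {t : ℝ}
    (ht : 0 ≤ t) :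
    ((Finset.univ.filter fun σ : Fin m → Bool => m * t ≤ ∑ i, swapSign (σ i) * d i).card : ℝ) ≤
      2 ^ m * Real.exp (-(m * t ^ 2 / 2)) := by
  -- Exponential moments at the parameter `t`, which is optimal.
  have hmgf : ∑ σ : Fin m → Bool, Real.exp (t * ∑ i, swapSign (σ i) * d i) ≤
      2 ^ m * Real.exp (m * t ^ 2 / 2) := by
    have hprod : ∑ σ : Fin m → Bool, Real.exp (t * ∑ i, swapSign (σ i) * d i) =
        ∏ i, (2 * Real.cosh (t * d i)) := by
      have h1 : ∀ i, 2 * Real.cosh (t * d i) = ∑ b : Bool, Real.exp (t * (swapSign b * d i)) := by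
        intro i
        rw [Fintype.sum_bool, Real.cosh_eq]
        simp only [swapSign, if_true, Bool.false_eq_true, if_false]
        ring_nf
      simp_rw [h1]
      rw [Finset.prod_univ_sum, Fintype.piFinset_univ]
      refine Finset.sum_congr rfl fun σ _ => ?_
      rw [← Real.exp_sum, Finset.mul_sum]
    rw [hprod, Finset.prod_mul_distrib]
    simp only [Finset.prod_const, Finset.card_univ, Fintype.card_fin]
    gcongr
    calc ∏ i, Real.cosh (t * d i) ≤ ∏ _i : Fin m, Real.exp (t ^ 2 / 2) := by
          refine Finset.prod_le_prod (fun i _ => (Real.cosh_pos _).le) fun i _ => ?_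
          refine (Real.cosh_le_exp_half_sq _).trans (Real.exp_le_exp.2 ?_)
          have : d i ^ 2 ≤ 1 := (sq_le_one_iff_abs_le_one _).2 (hd i)
          rw [mul_pow]
          nlinarith [sq_nonneg t]
      _ = Real.exp (m * t ^ 2 / 2) := by
          rw [Finset.prod_const, Finset.card_univ, Fintype.card_fin, ← Real.exp_nat_mul]
          ring_nf
  have hmarkov : ((Finset.univ.filter fun σ : Fin m → Bool =>
      m * t ≤ ∑ i, swapSign (σ i) * d i).card : ℝ) * Real.exp (t * (m * t)) ≤
      ∑ σ : Fin m → Bool, Real.exp (t * ∑ i, swapSign (σ i) * d i) := by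
    rw [← nsmul_eq_mul, ← Finset.sum_const]
    refine (Finset.sum_le_sum fun σ hσ => ?_).trans
      (Finset.sum_le_sum_of_subset_of_nonneg (Finset.filter_subset _ _)
        fun σ _ _ => (Real.exp_pos _).le)
    exact Real.exp_le_exp.2 (mul_le_mul_of_nonneg_left (Finset.mem_filter.1 hσ).2 ht)
  have h := hmarkov.trans hmgf
  rw [← le_div_iff₀ (Real.exp_pos _), mul_div_assoc, ← Real.exp_sub] at h
  refine h.trans_eq ?_
  congr 2
  ring

theorem ghostGap_swapPair {X : Type*} {m : ℕ} (c h : X → Bool) (σ : Fin m → Bool)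
    (p : (Fin m → X) × (Fin m → X)) :
    ghostGap c h (swapPair σ p) = (1 / (m : ℝ)) * ∑ i, swapSign (σ i) *
      ((if h (p.2 i) ≠ c (p.2 i) then (1 : ℝ) else 0) -
        if h (p.1 i) ≠ c (p.1 i) then (1 : ℝ) else 0) := by
  unfold ghostGap empError
  rw [← mul_sub, ← Finset.sum_sub_distrib]
  congr 1
  refine Finset.sum_congr rfl fun i _ => ?_
  cases hσ : σ i <;> simp [swapPair, swapSign, hσ]

theorem card_filter_le_ghostGap_swapPair {X : Type*} {m : ℕ} (c h : X → Bool)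
    (p : (Fin m → X) × (Fin m → X)) {ε : ℝ} (hε : 0 < ε) :
    ((Finset.univ.filter fun σ : Fin m → Bool => ε / 2 ≤ ghostGap c h (swapPair σ p)).card : ℝ) ≤
      2 ^ m * Real.exp (-(m * ε ^ 2 / 8)) := by
  rcases Nat.eq_zero_or_pos m with rfl | hm
  · have : ¬ ε / 2 ≤ 0 := not_le.2 (half_pos hε)
    simp [ghostGap, empError, this]
  have hm' : (0 : ℝ) < m := by exact_mod_cast hm
  have key := card_filter_le_sum_swapSign_mul (d := fun i =>
      (if h (p.2 i) ≠ c (p.2 i) then (1 : ℝ) else 0) -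
        if h (p.1 i) ≠ c (p.1 i) then (1 : ℝ) else 0)
    (fun i => by split_ifs <;> norm_num) (half_pos hε).le
  have hset : (Finset.univ.filter fun σ : Fin m → Bool => ε / 2 ≤ ghostGap c h (swapPair σ p)) =
      Finset.univ.filter fun σ : Fin m → Bool => m * (ε / 2) ≤ ∑ i, swapSign (σ i) *
        ((if h (p.2 i) ≠ c (p.2 i) then (1 : ℝ) else 0) -
          if h (p.1 i) ≠ c (p.1 i) then (1 : ℝ) else 0) := by
    refine Finset.filter_congr fun σ _ => ?_
    rw [ghostGap_swapPair, one_div, ← div_eq_inv_mul, le_div_iff₀ hm', mul_comm]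
  rw [hset]
  refine key.trans_eq ?_
  congr 2
  ring

/-- For a fixed double sample, few swaps lead into the bad event: it depends on a concept only
through its labeling of the `2 * m` points, which the swaps merely permute, so the bound for a
single concept is summed over at most `growth C (2 * m)` concepts. -/
theorem sum_indicator_badEvent_swapPair_le {X : Type*} (C : Set (X → Bool)) (c : X → Bool) {m : ℕ}
    {ε : ℝ} (hε : 0 < ε) (p : (Fin m → X) × (Fin m → X)) :
    ∑ σ : Fin m → Bool, (badEvent C c m ε).indicator (fun _ => (1 : ℝ≥0∞)) (swapPair σ p) ≤
      ENNReal.ofReal (2 ^ m * (growth C (2 * m) * Real.exp (-(m * ε ^ 2 / 8)))) := by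
  classical
  let x : Fin (2 * m) → X := fun i => Fin.append p.1 p.2 (Fin.cast (two_mul m) i)
  have hx1 : ∀ i : Fin m, p.1 i = x (Fin.cast (two_mul m).symm (Fin.castAdd m i)) := by
    intro i; simp [x]
  have hx2 : ∀ i : Fin m, p.2 i = x (Fin.cast (two_mul m).symm (Fin.natAdd m i)) := fun i =>
    (Fin.append_right p.1 p.2 i).symm
  set V : Set (Fin (2 * m) → Bool) := (fun h : X → Bool => h ∘ x) '' C with hV
  have hpick : ∀ v : Fin (2 * m) → Bool, ∃ h : X → Bool, v ∈ V → h ∘ x = v := by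
    intro v
    by_cases hv : v ∈ V
    · obtain ⟨h, -, hh⟩ := hv
      exact ⟨h, fun _ => hh⟩
    · exact ⟨fun _ => false, fun h => absurd h hv⟩
  choose r hr using hpick
  have hcover : (Finset.univ.filter fun σ : Fin m → Bool => swapPair σ p ∈ badEvent C c m ε) ⊆
      V.toFinset.biUnion fun v =>
        Finset.univ.filter fun σ : Fin m → Bool => ε / 2 ≤ ghostGap c (r v) (swapPair σ p) := by
    intro σ hσ
    obtain ⟨h, hh, hgap⟩ := (Finset.mem_filter.1 hσ).2
    have hv : h ∘ x ∈ V := ⟨h, hh, rfl⟩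
    refine Finset.mem_biUnion.2 ⟨h ∘ x, mem_toFinset.2 hv, Finset.mem_filter.2
      ⟨Finset.mem_univ _, ?_⟩⟩
    have heq : ∀ j, r (h ∘ x) (x j) = h (x j) := fun j => congrFun (hr _ hv) j
    rw [ghostGap_swapPair] at hgap ⊢
    simpa only [hx1, hx2, heq] using hgap
  have hcard : ((Finset.univ.filter fun σ : Fin m → Bool =>
      swapPair σ p ∈ badEvent C c m ε).card : ℝ) ≤
      2 ^ m * (growth C (2 * m) * Real.exp (-(m * ε ^ 2 / 8))) := by
    calc ((Finset.univ.filter fun σ : Fin m → Bool => swapPair σ p ∈ badEvent C c m ε).card : ℝ)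
        ≤ ∑ v ∈ V.toFinset, ((Finset.univ.filter fun σ : Fin m → Bool =>
            ε / 2 ≤ ghostGap c (r v) (swapPair σ p)).card : ℝ) := by
          exact_mod_cast (Finset.card_le_card hcover).trans Finset.card_biUnion_le
      _ ≤ ∑ _v ∈ V.toFinset, 2 ^ m * Real.exp (-(m * ε ^ 2 / 8)) :=
          Finset.sum_le_sum fun v _ => card_filter_le_ghostGap_swapPair c (r v) p hε
      _ = V.ncard * (2 ^ m * Real.exp (-(m * ε ^ 2 / 8))) := by
          rw [Finset.sum_const, nsmul_eq_mul, ncard_eq_toFinset_card']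
      _ ≤ growth C (2 * m) * (2 ^ m * Real.exp (-(m * ε ^ 2 / 8))) := by
          gcongr
          exact ncard_image_comp_le_growth C x
      _ = _ := by ring
  have hsum : ∑ σ : Fin m → Bool,
      (badEvent C c m ε).indicator (fun _ => (1 : ℝ≥0∞)) (swapPair σ p) =
      ((Finset.univ.filter fun σ : Fin m → Bool => swapPair σ p ∈ badEvent C c m ε).card : ℝ≥0∞) := by
    simp [indicator_apply]
  rw [hsum, ← ENNReal.ofReal_natCast]
  exact ENNReal.ofReal_le_ofReal hcard

theorem doubleMeasure_badEvent_le {X : Type*} [MeasurableSpace X] (C : Set (X → Bool))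
    (c : X → Bool) (μ : Measure X) [IsProbabilityMeasure μ] {m : ℕ} {ε : ℝ} (hε : 0 < ε)
    (hE : NullMeasurableSet (badEvent C c m ε) (doubleMeasure μ m)) :
    doubleMeasure μ m (badEvent C c m ε) ≤
      ENNReal.ofReal (growth C (2 * m) * Real.exp (-(m * ε ^ 2 / 8))) := by
  rw [doubleMeasure_eq_lintegral_swapPair μ hE]
  calc _ ≤ ∫⁻ _p, ENNReal.ofReal (growth C (2 * m) * Real.exp (-(m * ε ^ 2 / 8)))
        ∂(doubleMeasure μ m) := by
        refine lintegral_mono fun p => ENNReal.div_le_of_le_mul ?_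
        refine (sum_indicator_badEvent_swapPair_le C c hε p).trans_eq ?_
        rw [ENNReal.ofReal_mul (by positivity), mul_comm, ENNReal.ofReal_pow (by norm_num),
          ENNReal.ofReal_ofNat]
    _ = _ := by rw [lintegral_const, measure_univ, mul_one]

/-- Chebyshev's inequality for the empirical error of a fixed concept, whose variance is at most
`1 / (4 * m)`. -/
theorem half_le_sampleMeasure_trueError_sub_le_empError {X : Type*} [MeasurableSpace X]
    (μ : Measure X) [IsProbabilityMeasure μ] {h c : X → Bool} (hh : Measurable h)
    (hc : Measurable c) {m : ℕ} {ε : ℝ} (hε : 0 < ε) (hm : 2 ≤ (m : ℝ) * ε ^ 2) :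
    1 / 2 ≤ sampleMeasure μ m {T | trueError μ h c - ε / 2 ≤ empError T h c} := by
  have hm0 : (0 : ℝ) < m := by
    rcases Nat.eq_zero_or_pos m with rfl | h
    · norm_num at hm
    · exact_mod_cast h
  let l : X → ℝ := fun x => if h x ≠ c x then 1 else 0
  have hset : MeasurableSet {x | h x ≠ c x} := (measurableSet_eq_fun hh hc).compl
  have hl : Measurable l := Measurable.ite hset measurable_const measurable_const
  have hlI : ∀ x, l x ∈ Icc (0 : ℝ) 1 := by
    intro x; simp only [l]; split_ifs <;> simp
  have hlL : MemLp l 2 μ := memLp_of_bounded (Eventually.of_forall hlI) hl.aestronglyMeasurable 2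
  have hmean : ∫ x, l x ∂μ = trueError μ h c := by
    have : l = {x | h x ≠ c x}.indicator fun _ => (1 : ℝ) := by
      funext x; simp [l, indicator_apply]
    rw [this, integral_indicator_const _ hset, smul_eq_mul, mul_one, trueError]
  have hlvar : ProbabilityTheory.variance l μ ≤ 1 / 4 := by
    refine (ProbabilityTheory.variance_le_sq_of_bounded (Eventually.of_forall hlI)
      hl.aemeasurable).trans_eq ?_
    norm_num
  let N : (Fin m → X) → ℝ := ∑ i, fun T => l (T i)
  have hcomp : ∀ i : Fin m, MemLp (fun T : Fin m → X => l (T i)) 2 (sampleMeasure μ m) := fun i =>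
    hlL.comp_measurePreserving (measurePreserving_eval (fun _ : Fin m => μ) i)
  have hN : MemLp N 2 (sampleMeasure μ m) := memLp_finsetSum' _ fun i _ => hcomp i
  have hNmean : ∫ T, N T ∂(sampleMeasure μ m) = m * trueError μ h c := by
    have h1 : ∀ T, N T = ∑ i, l (T i) := fun T => by simp [N]
    simp_rw [h1]
    rw [integral_finsetSum _ fun i _ => (hcomp i).integrable (by norm_num)]
    have h2 : ∀ i : Fin m, ∫ T, l (T i) ∂(sampleMeasure μ m) = trueError μ h c := fun i => by
      rw [← hmean]
      exact integral_comp_eval (μ := fun _ : Fin m => μ) (i := i) hl.aestronglyMeasurable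
    simp_rw [h2]
    simp
  have hNvar : ProbabilityTheory.variance N (sampleMeasure μ m) ≤ m * (1 / 4) := by
    have := ProbabilityTheory.variance_sum_pi (μ := fun _ : Fin m => μ) (X := fun _ => l)
      fun _ => hlL
    refine (this.trans_le (Finset.sum_le_sum fun i _ => hlvar)).trans_eq ?_
    simp
  have hcheb := ProbabilityTheory.meas_ge_le_variance_div_sq hN
    (c := m * (ε / 2)) (by positivity)
  have hbad : sampleMeasure μ m {T | trueError μ h c - ε / 2 ≤ empError T h c}ᶜ ≤ 1 / 2 := by
    calc sampleMeasure μ m {T | trueError μ h c - ε / 2 ≤ empError T h c}ᶜ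
        ≤ sampleMeasure μ m {T | m * (ε / 2) ≤ |N T - ∫ T, N T ∂(sampleMeasure μ m)|} := by
          refine measure_mono fun T hT => ?_
          have hT' : empError T h c < trueError μ h c - ε / 2 := not_le.1 hT
          have hNT : N T = m * empError T h c := by
            simp only [empError]
            rw [← mul_assoc, mul_one_div_cancel hm0.ne', one_mul]
            simp [N, l]
          show m * (ε / 2) ≤ |N T - ∫ T, N T ∂(sampleMeasure μ m)|
          rw [hNmean, hNT, ← mul_sub, abs_mul, abs_of_pos hm0, abs_sub_comm]
          exact mul_le_mul_of_nonneg_left (le_trans (by linarith) (le_abs_self _)) hm0.le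
      _ ≤ _ := hcheb
      _ ≤ ENNReal.ofReal (1 / 2) := by
          refine ENNReal.ofReal_le_ofReal ?_
          rw [div_le_iff₀ (by positivity)]
          nlinarith
      _ = 1 / 2 := by
          rw [ENNReal.ofReal_div_of_pos (by norm_num)]; simp
  have huniv : (1 : ℝ≥0∞) ≤ sampleMeasure μ m {T | trueError μ h c - ε / 2 ≤ empError T h c} +
      1 / 2 := by
    calc (1 : ℝ≥0∞) = sampleMeasure μ m univ := measure_univ.symm
      _ ≤ _ := by
        rw [← union_compl_self {T | trueError μ h c - ε / 2 ≤ empError T h c}]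
        exact (measure_union_le _ _).trans (add_le_add_right hbad _)
  have := tsub_le_iff_right.2 huniv
  rwa [one_div, ENNReal.one_sub_inv_two, ← one_div] at this

/-- One-sided symmetrization. Every deviating training sample has a witnessing concept, and a ghost
sample lands in the corresponding section of the bad event with probability at least `1 / 2`.
Markov's inequality is applied to the sections of a measurable hull of the bad event, so neither
the deviation event nor the choice of witnesses has to be measurable. -/
theorem sampleMeasure_deviationEvent_le {X : Type*} [MeasurableSpace X] {C : Set (X → Bool)}
    (hC : ∀ h ∈ C, Measurable h) (μ : Measure X) [IsProbabilityMeasure μ] {c : X → Bool}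
    (hc : Measurable c) {m : ℕ} {ε : ℝ} (hε : 0 < ε) (hm : 2 ≤ (m : ℝ) * ε ^ 2) :
    sampleMeasure μ m (deviationEvent C μ c m ε) ≤
      2 * doubleMeasure μ m (badEvent C c m ε) := by
  set E := badEvent C c m ε with hE
  set E' := toMeasurable (doubleMeasure μ m) E
  have hE' : MeasurableSet E' := measurableSet_toMeasurable _ _
  have hsub : deviationEvent C μ c m ε ⊆
      {S | 1 / 2 ≤ sampleMeasure μ m (Prod.mk S ⁻¹' E')} := by
    rintro S ⟨h, hh, hdev⟩
    refine (half_le_sampleMeasure_trueError_sub_le_empError μ (hC h hh) hc hε hm).trans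
      (measure_mono fun T hT => subset_toMeasurable _ _ ⟨h, hh, ?_⟩)
    have hT' : trueError μ h c - ε / 2 ≤ empError T h c := hT
    show ε / 2 ≤ empError T h c - empError S h c
    linarith
  have hmarkov := mul_meas_ge_le_lintegral (μ := sampleMeasure μ m)
    (measurable_measure_prodMk_left hE' (ν := sampleMeasure μ m)) (1 / 2)
  rw [← Measure.prod_apply hE'] at hmarkov
  have hle : 1 / 2 * sampleMeasure μ m (deviationEvent C μ c m ε) ≤ doubleMeasure μ m E := by
    refine (mul_le_mul_right (measure_mono hsub) _).trans (hmarkov.trans_eq ?_)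
    exact measure_toMeasurable E
  calc sampleMeasure μ m (deviationEvent C μ c m ε)
      = 2 * (1 / 2 * sampleMeasure μ m (deviationEvent C μ c m ε)) := by
        rw [← mul_assoc, one_div, ENNReal.mul_inv_cancel (by simp) (by simp), one_mul]
    _ ≤ _ := mul_le_mul_right hle _

/-! ### Consistent learners -/

theorem isPACLearner_of_isConsistentLearner {X : Type*} [MeasurableSpace X] {C : Set (X → Bool)}
    (hC : ∀ h ∈ C, Measurable h) (hWB : WBMeas C) (hvc : vcDim C < ⊤) {A : Learner X}
    (hA : IsConsistentLearner C A) : IsPACLearner C A := by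
  refine ⟨fun c hc m S => (hA c hc m S).1, fun ε δ hε _ hδ _ => ?_⟩
  obtain ⟨d, hd⟩ := exists_card_le_of_vcDim_lt_top hvc
  have hlim : Tendsto (fun m : ℕ => 2 * ((d + 1 : ℝ) *
      ((2 * (m : ℝ) + 1) ^ d * Real.exp (-(m * (ε ^ 2 / 8)))))) atTop (𝓝 0) := by
    simpa using ((tendsto_pow_mul_exp_neg_atTop d (a := ε ^ 2 / 8) (by positivity)).const_mul
      (d + 1 : ℝ)).const_mul 2
  have hlarge : ∀ᶠ m : ℕ in atTop, 2 ≤ (m : ℝ) * ε ^ 2 :=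
    (tendsto_natCast_atTop_atTop.atTop_mul_const (by positivity)).eventually_ge_atTop 2
  obtain ⟨m₀, hm₀⟩ := eventually_atTop.1 ((hlim.eventually_le_const hδ).and hlarge)
  refine ⟨m₀, fun m hm μ hμ c hc => ?_⟩
  obtain ⟨hδm, h2m⟩ := hm₀ m hm
  have hsub : {S : Fin m → X | ε < trueError μ (A.output c S) c} ⊆ deviationEvent C μ c m ε := by
    intro S hS
    have hS' : ε < trueError μ (A.output c S) c := hS
    obtain ⟨hmem, hcons⟩ := hA c hc m S
    refine ⟨A.output c S, hmem, ?_⟩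
    have : empError S (A.output c S) c = 0 := by simp [empError, hcons]
    rw [this, sub_zero]
    exact hS'.le
  calc sampleMeasure μ m {S | ε < trueError μ (A.output c S) c}
      ≤ 2 * doubleMeasure μ m (badEvent C c m ε) := (measure_mono hsub).trans
        (sampleMeasure_deviationEvent_le hC μ (hC c hc) hε h2m)
    _ ≤ 2 * ENNReal.ofReal (growth C (2 * m) * Real.exp (-(m * ε ^ 2 / 8))) :=
        mul_le_mul_right (doubleMeasure_badEvent_le C c μ hε (hWB μ hμ c (hC c hc) m ε hε)) _
    _ = ENNReal.ofReal (2 * (growth C (2 * m) * Real.exp (-(m * ε ^ 2 / 8)))) := by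
        rw [ENNReal.ofReal_mul (p := 2) (by norm_num), ENNReal.ofReal_ofNat]
    _ ≤ ENNReal.ofReal δ := by
        refine ENNReal.ofReal_le_ofReal (le_trans ?_ hδm)
        have hg : (growth C (2 * m) : ℝ) ≤ (d + 1) * (2 * (m : ℝ) + 1) ^ d := by
          exact_mod_cast growth_le_of_shatters_card_le hd (2 * m)
        rw [mul_div_assoc, ← mul_assoc (d + 1 : ℝ)]
        gcongr

theorem exists_isConsistentLearner {X : Type*} (C : Set (X → Bool)) :
    ∃ A : Learner X, IsConsistentLearner C A := by
  have hpick : ∀ (m : ℕ) (s : Fin m → X × Bool), ∃ h : X → Bool,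
      (∃ g ∈ C, ∀ i, g (s i).1 = (s i).2) → h ∈ C ∧ ∀ i, h (s i).1 = (s i).2 := by
    intro m s
    by_cases hs : ∃ g ∈ C, ∀ i, g (s i).1 = (s i).2
    · obtain ⟨g, hg⟩ := hs
      exact ⟨g, fun _ => hg⟩
    · exact ⟨fun _ => false, fun h => absurd h hs⟩
  choose A hA using hpick
  exact ⟨A, fun c hc m S => hA m _ ⟨c, hc, fun _ => rfl⟩⟩

end GhostGap

theorem mainTheorem7 {X : Type*} [MeasurableSpace X] (C : Set (X → Bool))
    (hC : ∀ h ∈ C, Measurable h) :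
    -- `WBMeas` makes every bad event of a realizable target a legitimate integrable event
    (GhostGap.WBMeas C →
      ∀ μ : Measure X, IsProbabilityMeasure μ → ∀ c ∈ C, ∀ (m : ℕ) (ε : ℝ), 0 < ε →
        NullMeasurableSet (GhostGap.badEvent C c m ε) (GhostGap.doubleMeasure μ m) ∧
        AEMeasurable ((GhostGap.badEvent C c m ε).indicator fun _ => (1 : ℝ≥0∞))
          (GhostGap.doubleMeasure μ m) ∧
        ∫⁻ p, (GhostGap.badEvent C c m ε).indicator (fun _ => (1 : ℝ≥0∞)) p
            ∂(GhostGap.doubleMeasure μ m) =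
          GhostGap.doubleMeasure μ m (GhostGap.badEvent C c m ε)) ∧
    -- this regularity of the single event at hand is what the symmetrization argument needs
    (∀ μ : Measure X, IsProbabilityMeasure μ → ∀ c ∈ C, ∀ (m : ℕ) (ε : ℝ), 0 < ε →
      (NullMeasurableSet (GhostGap.badEvent C c m ε) (GhostGap.doubleMeasure μ m) ↔
        AEMeasurable ((GhostGap.badEvent C c m ε).indicator fun _ => (1 : ℝ≥0∞))
          (GhostGap.doubleMeasure μ m)) ∧
      (NullMeasurableSet (GhostGap.badEvent C c m ε) (GhostGap.doubleMeasure μ m) →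
        (2 ≤ (m : ℝ) * ε ^ 2 →
          GhostGap.sampleMeasure μ m (GhostGap.deviationEvent C μ c m ε) ≤
            2 * GhostGap.doubleMeasure μ m (GhostGap.badEvent C c m ε)) ∧
        GhostGap.doubleMeasure μ m (GhostGap.badEvent C c m ε) =
          ∫⁻ p, (∑ σ : Fin m → Bool, (GhostGap.badEvent C c m ε).indicator
              (fun _ => (1 : ℝ≥0∞)) (GhostGap.swapPair σ p)) / 2 ^ m
            ∂(GhostGap.doubleMeasure μ m) ∧
        GhostGap.doubleMeasure μ m (GhostGap.badEvent C c m ε) ≤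
          ENNReal.ofReal
            ((GhostGap.growth C (2 * m) : ℝ) * Real.exp (-((m : ℝ) * ε ^ 2 / 8))))) ∧
    -- the realizable PAC conclusion
    (GhostGap.WBMeas C → GhostGap.vcDim C < ⊤ →
      (∀ A : GhostGap.Learner X, GhostGap.IsConsistentLearner C A → GhostGap.IsPACLearner C A) ∧
      ∃ A : GhostGap.Learner X, GhostGap.IsPACLearner C A) ∧
    -- the hypotheses do not entail measurability of the ghost-gap supremum map
    (∃ (Y : Type) (_ : MeasurableSpace Y) (D : Set (Y → Bool)),
      (∀ h ∈ D, Measurable h) ∧ GhostGap.WBMeas D ∧ GhostGap.vcDim D < ⊤ ∧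
      ∃ c ∈ D, ∃ m : ℕ, ¬ Measurable (GhostGap.ghostSup D c m)) := by
  refine ⟨fun hWB μ hμ c hc m ε hε => ?_, fun μ hμ c hc m ε hε => ⟨?_, fun hE => ⟨?_, ?_, ?_⟩⟩,
    fun hWB hvc => ⟨fun A hA => ?_, ?_⟩, ?_⟩
  · have hE := hWB μ hμ c (hC c hc) m ε hε
    exact ⟨hE, (aemeasurable_indicator_const_iff 1).2 hE, by
      rw [lintegral_indicator_const₀ hE, one_mul]⟩
  · exact (aemeasurable_indicator_const_iff 1).symm
  · exact GhostGap.sampleMeasure_deviationEvent_le hC μ (hC c hc) hε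
  · exact GhostGap.doubleMeasure_eq_lintegral_swapPair μ hE
  · exact GhostGap.doubleMeasure_badEvent_le C c μ hε hE
  · exact GhostGap.isPACLearner_of_isConsistentLearner hC hWB hvc hA
  · obtain ⟨A, hA⟩ := GhostGap.exists_isConsistentLearner C
    exact ⟨A, GhostGap.isPACLearner_of_isConsistentLearner hC hWB hvc hA⟩
  · exact GhostGap.exists_wbMeas_not_measurable_ghostSup
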